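/- Let $V$ be a finite set of vertices and $E\subseteq V\times V$ a finite set of directed edges. Consider a distributed discrete-time linear time-varying system $G$ over $(V,E)$: for each $(t,k)\in\mathbb N_0\times V$, $$\begin{bmatrix}x^{(k)}(t+1)\\ x^{(k)}_{\rm out}(t+1)\end{bmatrix}=A^{(k)}(t)\begin{bmatrix}x^{(k)}(t)\\ x^{(k)}_{\rm in}(t)\end{bmatrix}+B^{(k)}(t)u^{(k)}(t),\qquad y^{(k)}(t)=C^{(k)}(t)\begin{bmatrix}x^{(k)}(t)\\ x^{(k)}_{\rm in}(t)\end{bmatrix}+D^{(k)}(t)u^{(k)}(t),$$ with zero initial conditions. Here $x^{(k)}(t)\in\mathbb R^{n^{(k)}(t)}$ are the temporal states, $x^{(ij)}(t)\in\mathbb R^{n^{(ij)}(t)}$, $(i,j)\in E$, are the spatial states, $x^{(k)}_{\rm in}(t)$ is the concatenation of the $x^{(ik)}(t)$ with $(i,k)\in E$, $x^{(k)}_{\rm out}(t)$ is the concatenation of the $x^{(kj)}(t)$ with $(k,j)\in E$, and all dimensions (possibly zero) may vary with $t$, $k$ and $(i,j)$. The real matrices $A^{(k)}(t),B^{(k)}(t),C^{(k)}(t),D^{(k)}(t)$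 are uniformly bounded in $(t,k)$ in spectral norm. Suppose that the realization is balanced, with balanced generalized gramians $\Sigma^{(k)}(t)$, $\Sigma^{(ij)}(t)$; that is, these are diagonal matrices, uniformly bounded, and there is $\beta>0$ such that $\Sigma^{(k)}(t)\succ\beta I$ and $\Sigma^{(ij)}(t)\succ\beta I$ for all $t\in\mathbb N_0$, $k\in V$, $(i,j)\in E$, and, for all $(t,k)$, $$A^{(k)}(t)\begin{bmatrix}\Sigma^{(k)}(t)&0\\0&\Sigma^{(k)}_{\rm in}(t)\end{bmatrix}A^{(k)}(t)^T-\begin{bmatrix}\Sigma^{(k)}(t+1)&0\\0&\Sigma^{(k)}_{\rm out}(t+1)\end{bmatrix}+B^{(k)}(t)B^{(k)}(t)^T\prec-\beta I,$$ $$A^{(k)}(t)^T\begin{bmatrix}\Sigma^{(k)}(t+1)&0\\0&\Sigma^{(k)}_{\rm out}(t+1)\end{bmatrix}A^{(k)}(t)-\begin{bmatrix}\Sigma^{(k)}(t)&0\\0&\Sigma^{(k)}_{\rm in}(t)\end{bmatrix}+C^{(k)}(t)^TC^{(k)}(t)\prec-\beta I,$$ where $\Sigma^{(k)}_{\rm in}(t)$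 and $\Sigma^{(k)}_{\rm out}(t)$ are the block-diagonal matrices with blocks $\Sigma^{(ik)}(t)$, $(i,k)\in E$, and $\Sigma^{(kj)}(t)$, $(k,j)\in E$, respectively. Let $0\le r^{(k)}(t)\le n^{(k)}(t)$ and $0\le r^{(ij)}(t)\le n^{(ij)}(t)$ be integers, and partition $\Sigma^{(k)}(t)=\mathrm{diag}(\Gamma^{(k)}(t),\Omega^{(k)}(t))$ and $\Sigma^{(ij)}(t)=\mathrm{diag}(\Gamma^{(ij)}(t),\Omega^{(ij)}(t))$, where $\Gamma^{(k)}(t)$ and $\Gamma^{(ij)}(t)$ have sizes $r^{(k)}(t)$ and $r^{(ij)}(t)$ (blocks of size zero are allowed). Let $G_r$ be the balanced truncation of $G$: the distributed system over $(V,E)$ with state dimensions $r^{(k)}(t)$, $r^{(ij)}(t)$ whose state-space matrices are obtained from those of $G$ by keeping only the rows and columns that correspond to the first $r^{(k)}(t)$ coordinates of each $x^{(k)}(t)$ and the first $r^{(ij)}(t)$ coordinates of each $x^{(ij)}(t)$, with $D^{(k)}(t)$ unchanged. If $\Omega^{(k)}(t)=I$ and $\Omega^{(ij)}(t)=I$ for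 all $(t,k)\in\mathbb N_0\times V$ and $(i,j)\in E$, then $G$ and $G_r$ are stable (inputs in $\ell_2$ give states and outputs in $\ell_2$), and $$\|G-G_r\|=\sup_{0\ne u\in\ell_2}\frac{\|Gu-G_ru\|_2}{\|u\|_2}<2,\qquad \|w\|_2=\Big(\sum_{(t,k)}w^{(k)}(t)^Tw^{(k)}(t)\Big)^{1/2},$$ where the supremum over the empty set is $0$. -/

import Mathlib

open scoped Matrix ENNReal

/-! Distributed linear time-varying systems over a finite directed graph with vertex set `V` and
set of directed edges `E` (self-loops are allowed): the pair `(i, j)` lies in `E` if there is an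
edge from `i` to `j`. -/

/-- Signals `w : (t, k) ↦ w t k ∈ ℝ ^ d t k`, where `k` ranges over the vertices (or the edges). -/
abbrev Signal {K : Type*} (d : ℕ → K → ℕ) : Type _ := ∀ (t : ℕ) (k : K), Fin (d t k) → ℝ

/-- The `ℓ₂`-norm `(∑ w(t,k)ᵀ w(t,k)) ^ (1/2)` of a signal, with the value `∞` allowed. -/
noncomputable def l2Norm {K : Type*} {d : ℕ → K → ℕ} (w : Signal d) : ℝ≥0∞ :=
  (∑' p : ℕ × K, ENNReal.ofReal (w p.1 p.2 ⬝ᵥ w p.1 p.2)) ^ (1 / 2 : ℝ)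

/-- The signal has finite `ℓ₂`-norm. -/
def MemL2 {K : Type*} {d : ℕ → K → ℕ} (w : Signal d) : Prop := l2Norm w < ∞

/-- The `ℓ₂`-induced norm `sup {‖T u‖ / ‖u‖ : 0 ≠ u ∈ ℓ₂}` of a map between signal spaces. -/
noncomputable def l2InducedNorm {K : Type*} {d d' : ℕ → K → ℕ} (T : Signal d → Signal d') :
    ℝ≥0∞ :=
  ⨆ (u : Signal d) (_ : MemL2 u) (_ : u ≠ 0), l2Norm (T u) / l2Norm u

/-- State dimensions: those of the temporal (vertex) states and of the spatial (edge) states. -/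
structure StateDims {V : Type*} (E : Finset (V × V)) where
  node : ℕ → V → ℕ
  edge : ℕ → E → ℕ

namespace StateDims

variable {V : Type*} {E : Finset (V × V)}

/-- Coordinates of the vector formed by the temporal state of `k` and the spatial states of all
edges `(i, k)` that enter `k`. -/
abbrev InIdx (n : StateDims E) (t : ℕ) (k : V) : Type _ :=
  Fin (n.node t k) ⊕ (Σ i : {i : V // (i, k) ∈ E}, Fin (n.edge t ⟨(i.1, k), i.2⟩))

/-- Coordinates of the vector formed by the temporal state of `k` and the spatial states of all
edges `(k, j)` that leave `k`. -/
abbrev OutIdx (n : StateDims E) (t : ℕ) (k : V) : Type _ :=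
  Fin (n.node t k) ⊕ (Σ j : {j : V // (k, j) ∈ E}, Fin (n.edge t ⟨(k, j.1), j.2⟩))

/-- The dimensions `r` do not exceed the dimensions `n`. -/
structure Le (r n : StateDims E) : Prop where
  node : ∀ t k, r.node t k ≤ n.node t k
  edge : ∀ t e, r.edge t e ≤ n.edge t e

/-- The retained coordinates: the leading `r` coordinates of every temporal and spatial state. -/
def Le.keepIn {r n : StateDims E} (h : r.Le n) (t : ℕ) (k : V) : r.InIdx t k → n.InIdx t k :=
  Sum.map (Fin.castLE (h.node t k)) (Sigma.map id fun _ => Fin.castLE (h.edge t _))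

/-- The retained coordinates, for the states that leave `k`. -/
def Le.keepOut {r n : StateDims E} (h : r.Le n) (t : ℕ) (k : V) : r.OutIdx t k → n.OutIdx t k :=
  Sum.map (Fin.castLE (h.node t k)) (Sigma.map id fun _ => Fin.castLE (h.edge t _))

end StateDims

/-- A realization `(A, B, C, D)` of a distributed system with state dimensions `n`, input
dimensions `nu` and output dimensions `ny`. -/
structure DistSystem {V : Type*} {E : Finset (V × V)} (n : StateDims E) (nu ny : ℕ → V → ℕ) where
  A : ∀ (t : ℕ) (k : V), Matrix (n.OutIdx (t + 1) k) (n.InIdx t k) ℝ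
  B : ∀ (t : ℕ) (k : V), Matrix (n.OutIdx (t + 1) k) (Fin (nu t k)) ℝ
  C : ∀ (t : ℕ) (k : V), Matrix (Fin (ny t k)) (n.InIdx t k) ℝ
  D : ∀ (t : ℕ) (k : V), Matrix (Fin (ny t k)) (Fin (nu t k)) ℝ

/-- A family of square matrices, one for each temporal and each spatial state. -/
structure GramianFamily {V : Type*} {E : Finset (V × V)} (n : StateDims E) where
  node : ∀ (t : ℕ) (k : V), Matrix (Fin (n.node t k)) (Fin (n.node t k)) ℝ
  edge : ∀ (t : ℕ) (e : E), Matrix (Fin (n.edge t e)) (Fin (n.edge t e)) ℝ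

namespace GramianFamily

variable {V : Type*} [DecidableEq V] {E : Finset (V × V)} {n : StateDims E}

/-- `diag (X⁽ᵏ⁾(t), X_in⁽ᵏ⁾(t))`. -/
def inBlock (X : GramianFamily n) (t : ℕ) (k : V) : Matrix (n.InIdx t k) (n.InIdx t k) ℝ :=
  Matrix.fromBlocks (X.node t k) 0 0
    (Matrix.blockDiagonal' fun i : {i : V // (i, k) ∈ E} => X.edge t ⟨(i.1, k), i.2⟩)

/-- `diag (X⁽ᵏ⁾(t), X_out⁽ᵏ⁾(t))`. -/
def outBlock (X : GramianFamily n) (t : ℕ) (k : V) : Matrix (n.OutIdx t k) (n.OutIdx t k) ℝ :=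
  Matrix.fromBlocks (X.node t k) 0 0
    (Matrix.blockDiagonal' fun j : {j : V // (k, j) ∈ E} => X.edge t ⟨(k, j.1), j.2⟩)

/-- All blocks satisfy `X ≻ β I`. -/
def GtScalar (X : GramianFamily n) (β : ℝ) : Prop :=
  (∀ t k, (X.node t k - β • (1 : Matrix _ _ ℝ)).PosDef) ∧
    ∀ t e, (X.edge t e - β • (1 : Matrix _ _ ℝ)).PosDef

open scoped Matrix.Norms.L2Operator in
/-- The blocks are uniformly bounded in the spectral norm. -/
def UniformlyBounded (X : GramianFamily n) : Prop :=
  ∃ c : ℝ, (∀ t k, ‖X.node t k‖ ≤ c) ∧ ∀ t e, ‖X.edge t e‖ ≤ c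

/-- All blocks are diagonal matrices. -/
def IsDiag (X : GramianFamily n) : Prop :=
  (∀ t k, (X.node t k).IsDiag) ∧ ∀ t e, (X.edge t e).IsDiag

/-- The trailing block `Ω⁽ᵏ⁾(t)` of `X⁽ᵏ⁾(t)`: rows and columns with (zero-based) index at least
`r⁽ᵏ⁾(t)`, which belong to the truncated coordinates. -/
def truncNode (X : GramianFamily n) (r : StateDims E) (t : ℕ) (k : V) :
    Matrix {a : Fin (n.node t k) // r.node t k ≤ a} {a : Fin (n.node t k) // r.node t k ≤ a} ℝ :=
  (X.node t k).toSquareBlockProp fun a => r.node t k ≤ a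

/-- The trailing block `Ω⁽ⁱʲ⁾(t)` of `X⁽ⁱʲ⁾(t)`. -/
def truncEdge (X : GramianFamily n) (r : StateDims E) (t : ℕ) (e : E) :
    Matrix {a : Fin (n.edge t e) // r.edge t e ≤ a} {a : Fin (n.edge t e) // r.edge t e ≤ a} ℝ :=
  (X.edge t e).toSquareBlockProp fun a => r.edge t e ≤ a

end GramianFamily

namespace DistSystem

variable {V : Type*} [Fintype V] [DecidableEq V] {E : Finset (V × V)} {n : StateDims E}
  {nu ny : ℕ → V → ℕ}

/-- The vector `(x⁽ᵏ⁾(t), x_in⁽ᵏ⁾(t))`, from temporal states `x` and spatial states `z`. -/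
def inVec {t : ℕ} (x : ∀ k : V, Fin (n.node t k) → ℝ) (z : ∀ e : E, Fin (n.edge t e) → ℝ)
    (k : V) : n.InIdx t k → ℝ :=
  Sum.elim (x k) fun q => z ⟨(q.1.1, k), q.1.2⟩ q.2

/-- The vector `(x⁽ᵏ⁾(t), x_out⁽ᵏ⁾(t))`, from temporal states `x` and spatial states `z`. -/
def outVec {t : ℕ} (x : ∀ k : V, Fin (n.node t k) → ℝ) (z : ∀ e : E, Fin (n.edge t e) → ℝ)
    (k : V) : n.OutIdx t k → ℝ :=
  Sum.elim (x k) fun q => z ⟨(k, q.1.1), q.1.2⟩ q.2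

/-- The state-space equations, with zero initial conditions, for the input `u`, the temporal
states `x`, the spatial states `z` and the output `y`. -/
structure IsSolution (G : DistSystem n nu ny) (u : Signal nu) (x : Signal n.node)
    (z : Signal n.edge) (y : Signal ny) : Prop where
  node_zero : x 0 = 0
  edge_zero : z 0 = 0
  state_succ : ∀ t k, outVec (x (t + 1)) (z (t + 1)) k =
    G.A t k *ᵥ inVec (x t) (z t) k + G.B t k *ᵥ u t k
  output_eq : ∀ t k, y t k = G.C t k *ᵥ inVec (x t) (z t) k + G.D t k *ᵥ u t k

/-- The temporal and spatial states at time `t` in response to the input `u`. -/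
def state (G : DistSystem n nu ny) (u : Signal nu) :
    (t : ℕ) → (∀ k : V, Fin (n.node t k) → ℝ) × (∀ e : E, Fin (n.edge t e) → ℝ)
  | 0 => (0, 0)
  | t + 1 =>
    (fun k a => (G.A t k *ᵥ inVec (G.state u t).1 (G.state u t).2 k + G.B t k *ᵥ u t k)
        (Sum.inl a),
      fun e a => (G.A t e.1.1 *ᵥ inVec (G.state u t).1 (G.state u t).2 e.1.1 +
        G.B t e.1.1 *ᵥ u t e.1.1) (Sum.inr ⟨⟨e.1.2, e.2⟩, a⟩))

/-- The temporal states in response to the input `u`. -/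
def nodeState (G : DistSystem n nu ny) (u : Signal nu) : Signal n.node := fun t => (G.state u t).1

/-- The spatial states in response to the input `u`. -/
def edgeState (G : DistSystem n nu ny) (u : Signal nu) : Signal n.edge := fun t => (G.state u t).2

/-- The input-output map of the system. -/
def output (G : DistSystem n nu ny) (u : Signal nu) : Signal ny := fun t k =>
  G.C t k *ᵥ inVec (G.nodeState u t) (G.edgeState u t) k + G.D t k *ᵥ u t k

/-- The recursively defined signals are the unique solution of the state-space equations. -/
theorem isSolution_iff (G : DistSystem n nu ny) (u : Signal nu) (x : Signal n.node)
    (z : Signal n.edge) (y : Signal ny) :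
    G.IsSolution u x z y ↔ x = G.nodeState u ∧ z = G.edgeState u ∧ y = G.output u := by
  constructor
  · intro h
    have key : ∀ t, x t = G.nodeState u t ∧ z t = G.edgeState u t := by
      intro t
      induction t with
      | zero => exact ⟨h.node_zero, h.edge_zero⟩
      | succ t ih =>
        have hs := h.state_succ t
        rw [ih.1, ih.2] at hs
        constructor
        · funext k a
          exact congrFun (hs k) (Sum.inl a)
        · funext e a
          exact congrFun (hs e.1.1) (Sum.inr ⟨⟨e.1.2, e.2⟩, a⟩)
    have hx : x = G.nodeState u := funext fun t => (key t).1
    have hz : z = G.edgeState u := funext fun t => (key t).2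
    subst hx hz
    exact ⟨rfl, rfl, funext fun t => funext fun k => h.output_eq t k⟩
  · rintro ⟨rfl, rfl, rfl⟩
    refine ⟨rfl, rfl, fun t k => ?_, fun t k => rfl⟩
    funext q
    rcases q with a | ⟨j, a⟩ <;> rfl

/-- Stability: inputs in `ℓ₂` give states and outputs in `ℓ₂`. (The solution is always unique, and
depends linearly and causally on the input.) -/
def IsStable (G : DistSystem n nu ny) : Prop :=
  ∀ u : Signal nu, MemL2 u → MemL2 (G.nodeState u) ∧ MemL2 (G.edgeState u) ∧ MemL2 (G.output u)

open scoped Matrix.Norms.L2Operator in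
/-- The state-space matrices are uniformly bounded in the spectral norm. -/
def UniformlyBounded (G : DistSystem n nu ny) : Prop :=
  ∃ c : ℝ, ∀ t k, ‖G.A t k‖ ≤ c ∧ ‖G.B t k‖ ≤ c ∧ ‖G.C t k‖ ≤ c ∧ ‖G.D t k‖ ≤ c

/-- The generalized controllability Lyapunov inequality
`A X_in Aᵀ - X_out(t+1) + B Bᵀ ≺ -β I`. -/
def CtrlLyapunov (G : DistSystem n nu ny) (X : GramianFamily n) (β : ℝ) : Prop :=
  ∀ t k, (-(β • (1 : Matrix _ _ ℝ)) - (G.A t k * X.inBlock t k * (G.A t k)ᵀ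
    - X.outBlock (t + 1) k + G.B t k * (G.B t k)ᵀ)).PosDef

/-- The generalized observability Lyapunov inequality
`Aᵀ Y_out(t+1) A - Y_in + Cᵀ C ≺ -β I`. -/
def ObsvLyapunov (G : DistSystem n nu ny) (Y : GramianFamily n) (β : ℝ) : Prop :=
  ∀ t k, (-(β • (1 : Matrix _ _ ℝ)) - ((G.A t k)ᵀ * Y.outBlock (t + 1) k * G.A t k
    - Y.inBlock t k + (G.C t k)ᵀ * G.C t k)).PosDef

/-- The realization is balanced, with balanced generalized gramians `S`. -/
def IsBalanced (G : DistSystem n nu ny) (S : GramianFamily n) : Prop :=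
  S.UniformlyBounded ∧ S.IsDiag ∧
    ∃ β : ℝ, 0 < β ∧ S.GtScalar β ∧ G.CtrlLyapunov S β ∧ G.ObsvLyapunov S β

/-- Balanced truncation: the reduced order realization that keeps the leading `r` coordinates of
every temporal and spatial state. -/
def truncate (G : DistSystem n nu ny) {r : StateDims E} (h : r.Le n) : DistSystem r nu ny where
  A t k := (G.A t k).submatrix (h.keepOut (t + 1) k) (h.keepIn t k)
  B t k := (G.B t k).submatrix (h.keepOut (t + 1) k) id
  C t k := (G.C t k).submatrix id (h.keepIn t k)
  D t k := G.D t k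

end DistSystem

/-! Run the truncated system inside the full state space: `masked` resets the discarded coordinates
to zero at every step, and its state `y` is the truncated state padded with zeros
(`isZeroExtension_state`). With `x` the state of `G`, use the storage function `|x - y|²` weighted
by `Σ` plus `|x + y|²` weighted by `Σ⁻¹`. Before resetting, both states move by the same `A`, `B`.
The input cancels in `x - y`, so the observability inequality pays for the output error. The sum `x
+ y` is driven by `2u`, so the dual controllability inequality (`sum_inv_mul_sq_le_of_posDef`) costs
at most `4θ|u|²`. Resetting does not increase the storage because the discarded weights are `1` in
both `Σ` and `Σ⁻¹` (`sum_energy_masked_le`). Telescoping from zero initial states gives a norm of at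
most `2√θ` (`l2InducedNorm_sub_masked_le`). The uniform margin `β` and an upper bound `c` on the
weights give `θ = 1 - β / c < 1`; this makes the bound strict. The same contraction of the
`Σ⁻¹`-energy gives stability of `G` and, since masking preserves it, of the truncation
(`CtrlDissipative.isStable`). -/

open Finset

/-! ### Quadratic inequalities at a single vertex and time. -/

section LyapunovInequalities

variable {p q m l : Type*} [Fintype p] [Fintype q] [Fintype m] [Fintype l]

theorem dotProduct_self_eq_sum_sq (v : p → ℝ) : v ⬝ᵥ v = ∑ i, v i ^ 2 := by
  simp [dotProduct, sq]

theorem dotProduct_diagonal_mulVec [DecidableEq p] (d v : p → ℝ) :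
    v ⬝ᵥ (Matrix.diagonal d *ᵥ v) = ∑ i, d i * v i ^ 2 := by
  simp only [dotProduct, Matrix.mulVec_diagonal]
  exact sum_congr rfl fun i _ => by ring

/-- A strict observability Lyapunov inequality gives a dissipation inequality. -/
theorem sum_mul_sq_mulVec_le_of_posDef [DecidableEq p] [DecidableEq q] {A : Matrix p q ℝ}
    {C : Matrix l q ℝ} {dp : p → ℝ} {dq : q → ℝ} {β : ℝ} (hβ : 0 ≤ β)
    (h : (-(β • (1 : Matrix q q ℝ)) - (Aᵀ * Matrix.diagonal dp * A - Matrix.diagonal dq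
      + Cᵀ * C)).PosDef) (x : q → ℝ) :
    ∑ i, dp i * (A *ᵥ x) i ^ 2 + ∑ i, (C *ᵥ x) i ^ 2 ≤ ∑ j, dq j * x j ^ 2 := by
  have h1 := h.posSemidef.dotProduct_mulVec_nonneg x
  have hA : x ⬝ᵥ ((Aᵀ * Matrix.diagonal dp * A) *ᵥ x) = ∑ i, dp i * (A *ᵥ x) i ^ 2 := by
    rw [← dotProduct_diagonal_mulVec, ← Matrix.mulVec_mulVec, ← Matrix.mulVec_mulVec,
      Matrix.dotProduct_mulVec, Matrix.vecMul_transpose]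
  have hC : x ⬝ᵥ ((Cᵀ * C) *ᵥ x) = ∑ i, (C *ᵥ x) i ^ 2 := by
    rw [← dotProduct_self_eq_sum_sq, ← Matrix.mulVec_mulVec,
      Matrix.dotProduct_mulVec, Matrix.vecMul_transpose]
  -- The margin is discarded here; the strictness of the final bound comes from the controllability
  -- side alone.
  have h0 : 0 ≤ β * ∑ i, x i ^ 2 := mul_nonneg hβ (sum_nonneg fun i _ => sq_nonneg _)
  simp only [star_trivial, Matrix.sub_mulVec, Matrix.add_mulVec, Matrix.neg_mulVec,
    Matrix.smul_mulVec, Matrix.one_mulVec, dotProduct_sub, dotProduct_add, dotProduct_neg,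
    dotProduct_smul, hA, hC, dotProduct_diagonal_mulVec, dotProduct_self_eq_sum_sq,
    smul_eq_mul] at h1
  linarith

/-- The dual of the strict controllability Lyapunov inequality. -/
theorem sum_inv_mul_sq_le_of_posDef [DecidableEq p] [DecidableEq q] {A : Matrix p q ℝ}
    {B : Matrix p m ℝ} {dp : p → ℝ} {dq : q → ℝ} {β c : ℝ} (hβ : 0 < β) (hc : β < c)
    (hp : ∀ i, 0 < dp i) (hpc : ∀ i, dp i ≤ c) (hq : ∀ j, 0 < dq j)
    (h : (-(β • (1 : Matrix p p ℝ)) - (A * Matrix.diagonal dq * Aᵀ - Matrix.diagonal dp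
      + B * Bᵀ)).PosDef) (x : q → ℝ) (v : m → ℝ) :
    ∑ i, (dp i)⁻¹ * (A *ᵥ x + B *ᵥ v) i ^ 2 ≤
      (1 - β / c) * (∑ j, (dq j)⁻¹ * x j ^ 2 + ∑ j, v j ^ 2) := by
  have hc0 : 0 < c := hβ.trans hc
  set θ := 1 - β / c with hθ
  have hθ0 : 0 < θ := by
    rw [hθ, sub_pos, div_lt_one hc0]; exact hc
  -- Testing the matrix inequality on this vector realizes the Schur-complement duality: `y` paired
  -- with `A x + B v` is exactly `N`.
  set y : p → ℝ := fun i => (dp i)⁻¹ * (A *ᵥ x + B *ᵥ v) i with hy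
  set N := ∑ i, (dp i)⁻¹ * (A *ᵥ x + B *ᵥ v) i ^ 2 with hN
  have h1 := h.posSemidef.dotProduct_mulVec_nonneg y
  have hA : y ⬝ᵥ ((A * Matrix.diagonal dq * Aᵀ) *ᵥ y) = ∑ j, dq j * (Aᵀ *ᵥ y) j ^ 2 := by
    rw [← dotProduct_diagonal_mulVec, ← Matrix.mulVec_mulVec, ← Matrix.mulVec_mulVec,
      Matrix.dotProduct_mulVec, ← Matrix.mulVec_transpose]
  have hB : y ⬝ᵥ ((B * Bᵀ) *ᵥ y) = ∑ i, (Bᵀ *ᵥ y) i ^ 2 := by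
    rw [← dotProduct_self_eq_sum_sq, ← Matrix.mulVec_mulVec,
      Matrix.dotProduct_mulVec, ← Matrix.mulVec_transpose]
  have hyN : ∑ i, dp i * y i ^ 2 = N :=
    sum_congr rfl fun i _ => by have := (hp i).ne'; simp only [hy]; field_simp
  -- Since `dp ≤ c`, the margin `β |y|²` is at least the fraction `β / c` of `N`; this produces the
  -- contraction factor.
  have hyc : β / c * N ≤ β * ∑ i, y i ^ 2 := by
    rw [← hyN, mul_sum, mul_sum]
    refine sum_le_sum fun i _ => ?_
    rw [div_mul_eq_mul_div, div_le_iff₀ hc0]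
    nlinarith [mul_nonneg hβ.le (mul_nonneg (sub_nonneg.2 (hpc i)) (sq_nonneg (y i)))]
  have hM : ∑ j, dq j * (Aᵀ *ᵥ y) j ^ 2 + ∑ i, (Bᵀ *ᵥ y) i ^ 2 ≤ θ * N := by
    simp only [star_trivial, Matrix.sub_mulVec, Matrix.add_mulVec, Matrix.neg_mulVec,
      Matrix.smul_mulVec, Matrix.one_mulVec, dotProduct_sub, dotProduct_add, dotProduct_neg,
      dotProduct_smul, hA, hB, dotProduct_diagonal_mulVec, dotProduct_self_eq_sum_sq,
      smul_eq_mul, hyN] at h1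
    rw [hθ]; linarith
  have hNy : N = ∑ j, (Aᵀ *ᵥ y) j * x j + ∑ j, (Bᵀ *ᵥ y) j * v j := by
    have : N = y ⬝ᵥ (A *ᵥ x + B *ᵥ v) := sum_congr rfl fun i _ => by simp only [hy]; ring
    rw [this, dotProduct_add, Matrix.dotProduct_mulVec, Matrix.dotProduct_mulVec,
      ← Matrix.mulVec_transpose, ← Matrix.mulVec_transpose]
    rfl
  -- The parameter `θ` is chosen so that `hM` absorbs half of `2 θ N`; what remains carries `θ ^ 2`,
  -- and cancelling one `θ` leaves the claimed factor.
  have young : ∀ a b d : ℝ, 0 < d → 2 * θ * (a * b) ≤ d * a ^ 2 + θ ^ 2 * (d⁻¹ * b ^ 2) := by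
    intro a b d hd
    have e : d * a ^ 2 + θ ^ 2 * (d⁻¹ * b ^ 2) - 2 * θ * (a * b) = d⁻¹ * (d * a - θ * b) ^ 2 := by
      field_simp; ring
    have : 0 ≤ d⁻¹ * (d * a - θ * b) ^ 2 := by positivity
    linarith
  have hA' : 2 * θ * ∑ j, (Aᵀ *ᵥ y) j * x j ≤
      ∑ j, dq j * (Aᵀ *ᵥ y) j ^ 2 + θ ^ 2 * ∑ j, (dq j)⁻¹ * x j ^ 2 := by
    rw [mul_sum, mul_sum, ← sum_add_distrib]
    exact sum_le_sum fun j _ => young _ _ _ (hq j)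
  have hB' : 2 * θ * ∑ j, (Bᵀ *ᵥ y) j * v j ≤
      ∑ j, (Bᵀ *ᵥ y) j ^ 2 + θ ^ 2 * ∑ j, v j ^ 2 := by
    rw [mul_sum, mul_sum, ← sum_add_distrib]
    exact sum_le_sum fun j _ => by simpa using young _ (v j) 1 one_pos
  refine le_of_mul_le_mul_left ?_ hθ0
  have : 2 * θ * N ≤ θ * N + θ ^ 2 * (∑ j, (dq j)⁻¹ * x j ^ 2 + ∑ j, v j ^ 2) := by
    conv_lhs => rw [hNy]
    linarith
  nlinarith

/-- Resetting coordinates of weight one does not increase the sum of the two energies. -/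
theorem sum_energy_masked_le {d a b b' : p → ℝ} (h : ∀ i, b' i = b i ∨ (b' i = 0 ∧ d i = 1)) :
    ∑ i, d i * (a i - b' i) ^ 2 + ∑ i, (d i)⁻¹ * (a i + b' i) ^ 2 ≤
      ∑ i, d i * (a i - b i) ^ 2 + ∑ i, (d i)⁻¹ * (a i + b i) ^ 2 := by
  rw [← sum_add_distrib, ← sum_add_distrib]
  refine sum_le_sum fun i _ => ?_
  rcases h i with h | ⟨h, hd⟩
  · rw [h]
  · rw [h, hd]
    -- With weight one the two squares add up to `2 a² + 2 b²`, against `2 a²` after the reset.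
    nlinarith [sq_nonneg (b i)]

open scoped Matrix.Norms.L2Operator in
theorem sum_sq_mulVec_le [DecidableEq q] {M : Matrix p q ℝ} {c : ℝ} (h : ‖M‖ ≤ c) (x : q → ℝ) :
    ∑ i, (M *ᵥ x) i ^ 2 ≤ c ^ 2 * ∑ j, x j ^ 2 := by
  have h1 := Matrix.l2_opNorm_mulVec M (WithLp.toLp 2 x)
  have h2 := h1.trans (mul_le_mul_of_nonneg_right h (norm_nonneg _))
  have h3 := pow_le_pow_left₀ (norm_nonneg _) h2 2
  rw [mul_pow, EuclideanSpace.real_norm_sq_eq, EuclideanSpace.real_norm_sq_eq] at h3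
  exact h3

end LyapunovInequalities

/-! ### Zero padding, and summation of dissipation inequalities over time. -/

theorem submatrix_mulVec_comp {p q p' q' : Type*} [Fintype q] [Fintype q'] (M : Matrix p q ℝ) (g : p' → p)
    {f : q' → q} (hf : f.Injective) {v : q → ℝ} (hv : ∀ j, j ∉ Set.range f → v j = 0) :
    M.submatrix g f *ᵥ (v ∘ f) = (M *ᵥ v) ∘ g := by
  funext i
  exact Fintype.sum_of_injective f hf _ _ (fun j hj => by simp [hv j hj]) fun j => rfl

theorem sum_range_le_of_dissipation {V U : ℕ → ℝ} {θ : ℝ} (h0 : V 0 = 0)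
    (hV : ∀ t, 0 ≤ V t) (h : ∀ t, V (t + 1) ≤ θ * (V t + U t)) (T : ℕ) :
    (1 - θ) * ∑ t ∈ range T, V t ≤ θ * ∑ t ∈ range T, U t := by
  -- Keeping the terminal storage `V T` lets the induction telescope; it is dropped only at the end.
  have key : (1 - θ) * ∑ t ∈ range T, V t + V T ≤ θ * ∑ t ∈ range T, U t := by
    induction T with
    | zero => simp [h0]
    | succ T ih =>
      rw [sum_range_succ, sum_range_succ]
      linarith [h T]
  linarith [hV T]

theorem sum_range_le_of_storage {V Y U : ℕ → ℝ} (h0 : V 0 = 0) (hV : ∀ t, 0 ≤ V t)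
    (h : ∀ t, V (t + 1) + Y t ≤ V t + U t) (T : ℕ) :
    ∑ t ∈ range T, Y t ≤ ∑ t ∈ range T, U t := by
  have key : ∑ t ∈ range T, Y t + V T ≤ ∑ t ∈ range T, U t := by
    induction T with
    | zero => simp [h0]
    | succ T ih =>
      rw [sum_range_succ, sum_range_succ]
      linarith [h T]
  linarith [hV T]

/-! ### Norms of signals from partial energies. -/

section Signals

variable {K K' : Type*} [Fintype K] [Fintype K'] {d : ℕ → K → ℕ} {d' : ℕ → K' → ℕ}

theorem l2Norm_eq (w : Signal d) :
    l2Norm w = (∑' t, ENNReal.ofReal (∑ k, w t k ⬝ᵥ w t k)) ^ (1 / 2 : ℝ) := by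
  unfold l2Norm
  rw [ENNReal.tsum_prod']
  congr 2
  funext t
  rw [tsum_fintype, ENNReal.ofReal_sum_of_nonneg]
  intro k _
  rw [dotProduct_self_eq_sum_sq]
  positivity

/-- Bounds on all partial energies give a bound on the `ℓ₂`-norm. -/
theorem l2Norm_le_of_sum_range_le {w : Signal d} {w' : Signal d'} {c : ℝ} (hc : 0 ≤ c)
    (h : ∀ T, ∑ t ∈ range T, ∑ k, w t k ⬝ᵥ w t k ≤
      c * ∑ t ∈ range T, ∑ k, w' t k ⬝ᵥ w' t k) :
    l2Norm w ≤ ENNReal.ofReal (√c) * l2Norm w' := by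
  have nn : ∀ t, 0 ≤ ∑ k, w t k ⬝ᵥ w t k := fun t => sum_nonneg fun k _ => by
    rw [dotProduct_self_eq_sum_sq]; positivity
  have nn' : ∀ t, 0 ≤ ∑ k, w' t k ⬝ᵥ w' t k := fun t => sum_nonneg fun k _ => by
    rw [dotProduct_self_eq_sum_sq]; positivity
  rw [l2Norm_eq, l2Norm_eq, Real.sqrt_eq_rpow, ← ENNReal.ofReal_rpow_of_nonneg hc (by norm_num),
    ← ENNReal.mul_rpow_of_nonneg _ _ (by norm_num)]
  refine ENNReal.rpow_le_rpow ?_ (by norm_num)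
  -- A series in `ℝ≥0∞` is the supremum of its partial sums, so no summability has to be known
  -- beforehand.
  rw [ENNReal.tsum_eq_iSup_nat]
  refine iSup_le fun T => ?_
  rw [← ENNReal.ofReal_sum_of_nonneg fun t _ => nn t]
  refine (ENNReal.ofReal_le_ofReal (h T)).trans ?_
  rw [ENNReal.ofReal_mul hc, ENNReal.ofReal_sum_of_nonneg fun t _ => nn' t]
  gcongr
  exact ENNReal.sum_le_tsum _

theorem memL2_of_sum_range_le {w : Signal d} {w' : Signal d'} {c : ℝ} (hc : 0 ≤ c)
    (h : ∀ T, ∑ t ∈ range T, ∑ k, w t k ⬝ᵥ w t k ≤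
      c * ∑ t ∈ range T, ∑ k, w' t k ⬝ᵥ w' t k) (hw' : MemL2 w') : MemL2 w :=
  (l2Norm_le_of_sum_range_le hc h).trans_lt (ENNReal.mul_lt_top ENNReal.ofReal_lt_top hw')

end Signals

/-! ### Joint state vectors and their weighted energies. -/

/-- The joint vectors of all temporal and all spatial states at time `t`. -/
abbrev StateVec {V : Type*} {E : Finset (V × V)} (n : StateDims E) (t : ℕ) : Type _ :=
  (∀ k : V, Fin (n.node t k) → ℝ) × (∀ e : E, Fin (n.edge t e) → ℝ)

namespace StateVec

variable {V : Type*} {E : Finset (V × V)} {n : StateDims E} {t : ℕ}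

theorem inVec_inv (w : StateVec n t) (k : V) (q : n.InIdx t k) :
    DistSystem.inVec (w⁻¹).1 (w⁻¹).2 k q = (DistSystem.inVec w.1 w.2 k q)⁻¹ := by
  rcases q with a | ⟨i, a⟩ <;> rfl

theorem outVec_inv (w : StateVec n t) (k : V) (q : n.OutIdx t k) :
    DistSystem.outVec (w⁻¹).1 (w⁻¹).2 k q = (DistSystem.outVec w.1 w.2 k q)⁻¹ := by
  rcases q with a | ⟨i, a⟩ <;> rfl

theorem inVec_add (x y : StateVec n t) (k : V) :
    DistSystem.inVec (x + y).1 (x + y).2 k =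
      DistSystem.inVec x.1 x.2 k + DistSystem.inVec y.1 y.2 k := by
  funext q
  rcases q with a | ⟨i, a⟩ <;> rfl

theorem inVec_sub (x y : StateVec n t) (k : V) :
    DistSystem.inVec (x - y).1 (x - y).2 k =
      DistSystem.inVec x.1 x.2 k - DistSystem.inVec y.1 y.2 k := by
  funext q
  rcases q with a | ⟨i, a⟩ <;> rfl

theorem outVec_add (x y : StateVec n t) (k : V) (q : n.OutIdx t k) :
    DistSystem.outVec (x + y).1 (x + y).2 k q =
      DistSystem.outVec x.1 x.2 k q + DistSystem.outVec y.1 y.2 k q := by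
  rcases q with a | ⟨i, a⟩ <;> rfl

theorem outVec_sub (x y : StateVec n t) (k : V) (q : n.OutIdx t k) :
    DistSystem.outVec (x - y).1 (x - y).2 k q =
      DistSystem.outVec x.1 x.2 k q - DistSystem.outVec y.1 y.2 k q := by
  rcases q with a | ⟨i, a⟩ <;> rfl

variable [Fintype V]

/-- The energy of a state vector with diagonal weights. -/
def energy (w x : StateVec n t) : ℝ :=
  ∑ k, ∑ a, w.1 k a * x.1 k a ^ 2 + ∑ e, ∑ a, w.2 e a * x.2 e a ^ 2

theorem energy_zero (w : StateVec n t) : energy w 0 = 0 := by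
  simp [energy]

theorem energy_nonneg {w : StateVec n t} (h1 : ∀ k a, 0 ≤ w.1 k a) (h2 : ∀ e a, 0 ≤ w.2 e a)
    (x : StateVec n t) : 0 ≤ energy w x :=
  add_nonneg (sum_nonneg fun k _ => sum_nonneg fun a _ => mul_nonneg (h1 k a) (sq_nonneg _))
    (sum_nonneg fun e _ => sum_nonneg fun a _ => mul_nonneg (h2 e a) (sq_nonneg _))

theorem sum_node_le_energy_one (x : StateVec n t) : ∑ k, x.1 k ⬝ᵥ x.1 k ≤ energy 1 x := by
  simp only [energy, dotProduct_self_eq_sum_sq, Prod.fst_one, Prod.snd_one, Pi.one_apply, one_mul]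
  exact le_add_of_nonneg_right (by positivity)

theorem sum_edge_le_energy_one (x : StateVec n t) : ∑ e, x.2 e ⬝ᵥ x.2 e ≤ energy 1 x := by
  simp only [energy, dotProduct_self_eq_sum_sq, Prod.fst_one, Prod.snd_one, Pi.one_apply, one_mul]
  exact le_add_of_nonneg_left (by positivity)

theorem energy_one_le {w : StateVec n t} {c : ℝ} (h1 : ∀ k a, 1 ≤ c * w.1 k a)
    (h2 : ∀ e a, 1 ≤ c * w.2 e a) (x : StateVec n t) : energy 1 x ≤ c * energy w x := by
  simp only [energy, Prod.fst_one, Prod.snd_one, Pi.one_apply, mul_add, mul_sum, ← mul_assoc]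
  gcongr with k _ a _ e _ a _
  · exact h1 k a
  · exact h2 e a

variable [DecidableEq V]

/-- Every edge has exactly one head, so each spatial state is counted at exactly one vertex. With
its analogue for tails, `sum_outVec`, this lets local inequalities be summed over the vertices into
global ones. -/
theorem sum_inVec (x : StateVec n t) :
    ∑ k, ∑ q, DistSystem.inVec x.1 x.2 k q = ∑ k, ∑ a, x.1 k a + ∑ e, ∑ a, x.2 e a := by
  simp only [Fintype.sum_sum_type, DistSystem.inVec, Sum.elim_inl, Sum.elim_inr,
    sum_add_distrib, Fintype.sum_sigma]
  congr 1
  rw [← Fintype.sum_sigma']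
  exact Fintype.sum_equiv
    { toFun := fun s : Σ k : V, {i : V // (i, k) ∈ E} => (⟨(s.2.1, s.1), s.2.2⟩ : E)
      invFun := fun e => ⟨e.1.2, ⟨e.1.1, e.2⟩⟩
      left_inv := fun _ => rfl
      right_inv := fun _ => rfl } _ _ fun s => rfl

theorem sum_outVec (x : StateVec n t) :
    ∑ k, ∑ q, DistSystem.outVec x.1 x.2 k q = ∑ k, ∑ a, x.1 k a + ∑ e, ∑ a, x.2 e a := by
  simp only [Fintype.sum_sum_type, DistSystem.outVec, Sum.elim_inl, Sum.elim_inr,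
    sum_add_distrib, Fintype.sum_sigma]
  congr 1
  rw [← Fintype.sum_sigma']
  exact Fintype.sum_equiv
    { toFun := fun s : Σ k : V, {j : V // (k, j) ∈ E} => (⟨(s.1, s.2.1), s.2.2⟩ : E)
      invFun := fun e => ⟨e.1.1, ⟨e.1.2, e.2⟩⟩
      left_inv := fun _ => rfl
      right_inv := fun _ => rfl } _ _ fun s => rfl

theorem sum_energy_inVec (w x : StateVec n t) :
    ∑ k, ∑ q, DistSystem.inVec w.1 w.2 k q * DistSystem.inVec x.1 x.2 k q ^ 2 = energy w x := by
  refine Eq.trans ?_ (sum_inVec (w * x ^ 2))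
  refine sum_congr rfl fun k _ => sum_congr rfl fun q _ => ?_
  rcases q with a | ⟨i, a⟩ <;> rfl

theorem sum_energy_outVec (w x : StateVec n t) :
    ∑ k, ∑ q, DistSystem.outVec w.1 w.2 k q * DistSystem.outVec x.1 x.2 k q ^ 2 = energy w x := by
  refine Eq.trans ?_ (sum_outVec (w * x ^ 2))
  refine sum_congr rfl fun k _ => sum_congr rfl fun q _ => ?_
  rcases q with a | ⟨i, a⟩ <;> rfl

end StateVec

/-! ### Diagonal gramians as weight vectors. -/

namespace GramianFamily

variable {V : Type*} {E : Finset (V × V)} {n : StateDims E}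

/-- The diagonal entries of a family of matrices. -/
def diagVec (S : GramianFamily n) (t : ℕ) : StateVec n t :=
  (fun k a => S.node t k a a, fun e a => S.edge t e a a)

theorem IsDiag.node_eq {S : GramianFamily n} (h : S.IsDiag) (t : ℕ) (k : V) :
    S.node t k = Matrix.diagonal ((S.diagVec t).1 k) :=
  (Matrix.isDiag_iff_diagonal_diag _).1 (h.1 t k) |>.symm

theorem IsDiag.edge_eq {S : GramianFamily n} (h : S.IsDiag) (t : ℕ) (e : E) :
    S.edge t e = Matrix.diagonal ((S.diagVec t).2 e) :=
  (Matrix.isDiag_iff_diagonal_diag _).1 (h.2 t e) |>.symm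

theorem GtScalar.node_lt {S : GramianFamily n} {β : ℝ} (h : S.GtScalar β) (t : ℕ) (k : V)
    (a : Fin (n.node t k)) : β < (S.diagVec t).1 k a := by
  have := (h.1 t k).diag_pos (i := a)
  simpa [diagVec] using this

theorem GtScalar.edge_lt {S : GramianFamily n} {β : ℝ} (h : S.GtScalar β) (t : ℕ) (e : E)
    (a : Fin (n.edge t e)) : β < (S.diagVec t).2 e a := by
  have := (h.2 t e).diag_pos (i := a)
  simpa [diagVec] using this

theorem UniformlyBounded.exists_le {S : GramianFamily n} (h : S.UniformlyBounded)
    (hd : S.IsDiag) :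
    ∃ c : ℝ, (∀ t k a, (S.diagVec t).1 k a ≤ c) ∧ ∀ t e a, (S.diagVec t).2 e a ≤ c := by
  obtain ⟨c, h1, h2⟩ := h
  refine ⟨c, fun t k a => ?_, fun t e a => ?_⟩
  · have := h1 t k
    rw [hd.node_eq, Matrix.l2_opNorm_diagonal] at this
    exact (le_abs_self _).trans ((norm_le_pi_norm ((S.diagVec t).1 k) a).trans this)
  · have := h2 t e
    rw [hd.edge_eq, Matrix.l2_opNorm_diagonal] at this
    exact (le_abs_self _).trans ((norm_le_pi_norm ((S.diagVec t).2 e) a).trans this)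

variable [DecidableEq V]

theorem IsDiag.inBlock_eq {S : GramianFamily n} (h : S.IsDiag) (t : ℕ) (k : V) :
    S.inBlock t k =
      Matrix.diagonal (DistSystem.inVec (S.diagVec t).1 (S.diagVec t).2 k) := by
  unfold inBlock
  simp only [h.node_eq, h.edge_eq, Matrix.blockDiagonal'_diagonal, Matrix.fromBlocks_diagonal]
  rfl

theorem IsDiag.outBlock_eq {S : GramianFamily n} (h : S.IsDiag) (t : ℕ) (k : V) :
    S.outBlock t k =
      Matrix.diagonal (DistSystem.outVec (S.diagVec t).1 (S.diagVec t).2 k) := by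
  unfold outBlock
  simp only [h.node_eq, h.edge_eq, Matrix.blockDiagonal'_diagonal, Matrix.fromBlocks_diagonal]
  rfl

end GramianFamily

/-! ### Zero extensions of truncated states. -/

namespace DistSystem

variable {V : Type*} {E : Finset (V × V)} {n r : StateDims E} {nu ny : ℕ → V → ℕ}

theorem keepIn_injective (h : r.Le n) (t : ℕ) (k : V) : (h.keepIn t k).Injective :=
  Function.Injective.sumMap (Fin.castLE_injective _)
    (Function.injective_id.sigma_map fun _ => Fin.castLE_injective _)

/-- `x` is the extension of `y` by zeros in the truncated coordinates. -/
structure IsZeroExtension (h : r.Le n) {t : ℕ} (y : StateVec r t) (x : StateVec n t) : Prop where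
  node : ∀ k a, x.1 k (Fin.castLE (h.node t k) a) = y.1 k a
  edge : ∀ e a, x.2 e (Fin.castLE (h.edge t e) a) = y.2 e a
  node_zero : ∀ k (a : Fin (n.node t k)), ¬ (a : ℕ) < r.node t k → x.1 k a = 0
  edge_zero : ∀ e (a : Fin (n.edge t e)), ¬ (a : ℕ) < r.edge t e → x.2 e a = 0

namespace IsZeroExtension

variable {h : r.Le n} {t : ℕ} {y : StateVec r t} {x : StateVec n t}

theorem submatrix_mulVec [Fintype V] [DecidableEq V] {p p' : Type*}
    (hx : IsZeroExtension h y x) (k : V)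
    (M : Matrix p (n.InIdx t k) ℝ) (g : p' → p) :
    M.submatrix g (h.keepIn t k) *ᵥ inVec y.1 y.2 k = (M *ᵥ inVec x.1 x.2 k) ∘ g := by
  have hc : inVec y.1 y.2 k = inVec x.1 x.2 k ∘ h.keepIn t k := by
    funext q
    rcases q with a | ⟨i, a⟩
    · exact (hx.node k a).symm
    · exact (hx.edge _ a).symm
  rw [hc]
  refine submatrix_mulVec_comp M g (keepIn_injective h t k) ?_
  rintro (a | ⟨i, a⟩) hq
  · exact hx.node_zero k a fun ha => hq ⟨Sum.inl ⟨a, ha⟩, rfl⟩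
  · exact hx.edge_zero _ a fun ha => hq ⟨Sum.inr ⟨i, ⟨a, ha⟩⟩, rfl⟩

theorem node_dotProduct (hx : IsZeroExtension h y x) (k : V) :
    y.1 k ⬝ᵥ y.1 k = x.1 k ⬝ᵥ x.1 k :=
  Fintype.sum_of_injective (Fin.castLE (h.node t k)) (Fin.castLE_injective _) _ _
    (fun a ha => by rw [hx.node_zero k a fun ha' => ha ⟨⟨a, ha'⟩, rfl⟩, zero_mul])
    fun a => by rw [hx.node]

theorem edge_dotProduct (hx : IsZeroExtension h y x) (e : E) :
    y.2 e ⬝ᵥ y.2 e = x.2 e ⬝ᵥ x.2 e :=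
  Fintype.sum_of_injective (Fin.castLE (h.edge t e)) (Fin.castLE_injective _) _ _
    (fun a ha => by rw [hx.edge_zero e a fun ha' => ha ⟨⟨a, ha'⟩, rfl⟩, zero_mul])
    fun a => by rw [hx.edge]

end IsZeroExtension

/-! ### Contraction of the inverse-gramian energy, and stability. -/

variable [Fintype V] [DecidableEq V]

theorem outVec_state_succ (G : DistSystem n nu ny) (u : Signal nu) (t : ℕ) (k : V) :
    outVec (G.state u (t + 1)).1 (G.state u (t + 1)).2 k =
      G.A t k *ᵥ inVec (G.state u t).1 (G.state u t).2 k + G.B t k *ᵥ u t k := by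
  funext q
  rcases q with a | ⟨j, a⟩ <;> rfl

/-- The local dissipation inequality dual to the controllability Lyapunov inequality, for the
storage function with weights `(w t)⁻¹`. -/
def CtrlDissipative (G : DistSystem n nu ny) (w : ∀ t, StateVec n t) (θ : ℝ) : Prop :=
  ∀ t k (x : n.InIdx t k → ℝ) (v : Fin (nu t k) → ℝ),
    ∑ q, (outVec (w (t + 1)).1 (w (t + 1)).2 k q)⁻¹ * (G.A t k *ᵥ x + G.B t k *ᵥ v) q ^ 2 ≤
      θ * (∑ q, (inVec (w t).1 (w t).2 k q)⁻¹ * x q ^ 2 + ∑ a, v a ^ 2)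

theorem CtrlLyapunov.ctrlDissipative {G : DistSystem n nu ny} {S : GramianFamily n} {β c : ℝ}
    (h : G.CtrlLyapunov S β) (hd : S.IsDiag) (hβ : 0 < β) (hS : S.GtScalar β) (hc : β < c)
    (hc1 : ∀ t k a, (S.diagVec t).1 k a ≤ c) (hc2 : ∀ t e a, (S.diagVec t).2 e a ≤ c) :
    G.CtrlDissipative S.diagVec (1 - β / c) := by
  intro t k x v
  have h' := h t k
  rw [hd.inBlock_eq, hd.outBlock_eq] at h'
  refine sum_inv_mul_sq_le_of_posDef hβ hc ?_ ?_ ?_ h' x v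
  · rintro (a | ⟨j, a⟩)
    · exact hβ.trans (hS.node_lt _ _ _)
    · exact hβ.trans (hS.edge_lt _ _ _)
  · rintro (a | ⟨j, a⟩)
    · exact hc1 _ _ _
    · exact hc2 _ _ _
  · rintro (a | ⟨j, a⟩)
    · exact hβ.trans (hS.node_lt _ _ _)
    · exact hβ.trans (hS.edge_lt _ _ _)

theorem CtrlDissipative.energy_succ_le {G : DistSystem n nu ny} {w : ∀ t, StateVec n t} {θ : ℝ}
    (h : G.CtrlDissipative w θ) (u : Signal nu) (t : ℕ) :
    StateVec.energy (w (t + 1))⁻¹ (G.state u (t + 1)) ≤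
      θ * (StateVec.energy (w t)⁻¹ (G.state u t) + ∑ k, u t k ⬝ᵥ u t k) := by
  rw [← StateVec.sum_energy_outVec, ← StateVec.sum_energy_inVec, ← sum_add_distrib, mul_sum]
  refine sum_le_sum fun k _ => ?_
  simp only [outVec_state_succ, StateVec.outVec_inv, StateVec.inVec_inv,
    dotProduct_self_eq_sum_sq]
  exact h t k _ _

theorem sum_output_le (G : DistSystem n nu ny) {c : ℝ} {t : ℕ}
    (hC : ∀ k (x : n.InIdx t k → ℝ), ∑ a, (G.C t k *ᵥ x) a ^ 2 ≤ c * ∑ q, x q ^ 2)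
    (hD : ∀ k (v : Fin (nu t k) → ℝ), ∑ a, (G.D t k *ᵥ v) a ^ 2 ≤ c * ∑ q, v q ^ 2)
    (u : Signal nu) :
    ∑ k, G.output u t k ⬝ᵥ G.output u t k ≤
      2 * c * (StateVec.energy 1 (G.state u t) + ∑ k, u t k ⬝ᵥ u t k) := by
  rw [← StateVec.sum_energy_inVec, ← sum_add_distrib, mul_sum]
  refine sum_le_sum fun k _ => ?_
  have h1 : ∑ q, inVec (1 : StateVec n t).1 (1 : StateVec n t).2 k q *
      inVec (G.state u t).1 (G.state u t).2 k q ^ 2 =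
      ∑ q, inVec (G.state u t).1 (G.state u t).2 k q ^ 2 :=
    sum_congr rfl fun q _ => by
      have : inVec (1 : StateVec n t).1 (1 : StateVec n t).2 k q = 1 := by
        rcases q with a | ⟨i, a⟩ <;> rfl
      rw [this, one_mul]
  have h2 : G.output u t k ⬝ᵥ G.output u t k ≤
      2 * ∑ a, (G.C t k *ᵥ inVec (G.state u t).1 (G.state u t).2 k) a ^ 2 +
        2 * ∑ a, (G.D t k *ᵥ u t k) a ^ 2 := by
    rw [dotProduct_self_eq_sum_sq, mul_sum, mul_sum, ← sum_add_distrib]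
    refine sum_le_sum fun a _ => ?_
    rw [← mul_add]
    exact add_sq_le
  rw [h1, dotProduct_self_eq_sum_sq (u t k)]
  linarith [hC k (inVec (G.state u t).1 (G.state u t).2 k), hD k (u t k)]

theorem CtrlDissipative.isStable {G : DistSystem n nu ny} {w : ∀ t, StateVec n t} {θ c b : ℝ}
    (h : G.CtrlDissipative w θ) (hθ0 : 0 ≤ θ) (hθ1 : θ < 1) (hc : 0 ≤ c)
    (hw1 : ∀ t k a, 0 < (w t).1 k a) (hw2 : ∀ t e a, 0 < (w t).2 e a)
    (hc1 : ∀ t k a, (w t).1 k a ≤ c) (hc2 : ∀ t e a, (w t).2 e a ≤ c) (hb : 0 ≤ b)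
    (hC : ∀ t k (x : n.InIdx t k → ℝ), ∑ a, (G.C t k *ᵥ x) a ^ 2 ≤ b * ∑ q, x q ^ 2)
    (hD : ∀ t k (v : Fin (nu t k) → ℝ), ∑ a, (G.D t k *ᵥ v) a ^ 2 ≤ b * ∑ q, v q ^ 2) :
    G.IsStable := by
  intro u hu
  have h1θ : 0 < 1 - θ := sub_pos.2 hθ1
  have key : ∀ T, ∑ t ∈ range T, StateVec.energy 1 (G.state u t) ≤
      c * θ / (1 - θ) * ∑ t ∈ range T, ∑ k, u t k ⬝ᵥ u t k := by
    intro T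
    have hsum := sum_range_le_of_dissipation
      (V := fun t => StateVec.energy (w t)⁻¹ (G.state u t))
      (StateVec.energy_zero _)
      (fun t => StateVec.energy_nonneg (fun k a => (inv_pos.2 (hw1 t k a)).le)
        (fun e a => (inv_pos.2 (hw2 t e a)).le) _)
      (h.energy_succ_le u) T
    -- The weights are at most `c`, so their inverses dominate `1 / c`.
    have hone : ∑ t ∈ range T, StateVec.energy 1 (G.state u t) ≤
        c * ∑ t ∈ range T, StateVec.energy (w t)⁻¹ (G.state u t) := by
      rw [mul_sum]
      refine sum_le_sum fun t _ => StateVec.energy_one_le (fun k a => ?_) (fun e a => ?_) _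
      · exact (le_mul_inv_iff₀ (hw1 t k a)).2 ((one_mul _).trans_le (hc1 t k a))
      · exact (le_mul_inv_iff₀ (hw2 t e a)).2 ((one_mul _).trans_le (hc2 t e a))
    rw [div_mul_eq_mul_div, le_div_iff₀ h1θ]
    nlinarith [mul_le_mul_of_nonneg_left hsum hc, mul_le_mul_of_nonneg_right hone h1θ.le]
  have hK : 0 ≤ c * θ / (1 - θ) := by positivity
  -- In the output constant, `2 * b` comes from `sum_output_le` and the `+ 1` from the feedthrough
  -- term.
  refine ⟨memL2_of_sum_range_le hK (fun T => ?_) hu, memL2_of_sum_range_le hK (fun T => ?_) hu,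
    memL2_of_sum_range_le (c := 2 * b * (c * θ / (1 - θ) + 1)) (by positivity) (fun T => ?_) hu⟩
  · exact (sum_le_sum fun t _ => StateVec.sum_node_le_energy_one _).trans (key T)
  · exact (sum_le_sum fun t _ => StateVec.sum_edge_le_energy_one _).trans (key T)
  · refine (sum_le_sum fun t _ => G.sum_output_le (hC t) (hD t) u).trans ?_
    rw [← mul_sum, sum_add_distrib, mul_assoc (2 * b)]
    gcongr
    linarith [key T]

/-! ### The masked system and its relation to the truncation. -/

/-- The coordinates among the outgoing states that a truncation to `r` retains. -/
def Retained (r : StateDims E) {t : ℕ} {k : V} : n.OutIdx t k → Prop :=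
  Sum.elim (fun a => (a : ℕ) < r.node t k) fun q => (q.2 : ℕ) < r.edge t ⟨(k, q.1.1), q.1.2⟩

open Classical in
/-- The system in which the truncated states are kept at zero. -/
noncomputable def masked (G : DistSystem n nu ny) (r : StateDims E) : DistSystem n nu ny where
  A t k := Matrix.of fun q p => if Retained r q then G.A t k q p else 0
  B t k := Matrix.of fun q p => if Retained r q then G.B t k q p else 0
  C := G.C
  D := G.D

theorem masked_mulVec_of_retained (G : DistSystem n nu ny) (r : StateDims E) {t : ℕ} {k : V}
    (x : n.InIdx t k → ℝ) (v : Fin (nu t k) → ℝ) {q : n.OutIdx (t + 1) k} (hq : Retained r q) :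
    ((G.masked r).A t k *ᵥ x + (G.masked r).B t k *ᵥ v) q =
      (G.A t k *ᵥ x + G.B t k *ᵥ v) q := by
  simp [masked, Matrix.mulVec, dotProduct, hq]

theorem masked_mulVec_of_not_retained (G : DistSystem n nu ny) (r : StateDims E) {t : ℕ} {k : V}
    (x : n.InIdx t k → ℝ) (v : Fin (nu t k) → ℝ) {q : n.OutIdx (t + 1) k} (hq : ¬ Retained r q) :
    ((G.masked r).A t k *ᵥ x + (G.masked r).B t k *ᵥ v) q = 0 := by
  simp [masked, Matrix.mulVec, dotProduct, hq]

/-- Masking only replaces some nonnegative terms on the left by zero. -/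
theorem CtrlDissipative.masked {G : DistSystem n nu ny} {w : ∀ t, StateVec n t} {θ : ℝ}
    (h : G.CtrlDissipative w θ) (hw1 : ∀ t k a, 0 < (w t).1 k a)
    (hw2 : ∀ t e a, 0 < (w t).2 e a) (r : StateDims E) : (G.masked r).CtrlDissipative w θ := by
  intro t k x v
  refine le_trans (sum_le_sum fun q _ => ?_) (h t k x v)
  have hq0 : 0 ≤ (outVec (w (t + 1)).1 (w (t + 1)).2 k q)⁻¹ := by
    rcases q with a | ⟨j, a⟩
    · exact (inv_pos.2 (hw1 _ _ _)).le
    · exact (inv_pos.2 (hw2 _ _ _)).le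
  by_cases hq : Retained r q
  · rw [G.masked_mulVec_of_retained r x v hq]
  · rw [G.masked_mulVec_of_not_retained r x v hq, sq, mul_zero, mul_zero]
    exact mul_nonneg hq0 (sq_nonneg _)

/-- Masking rows suffices: the columns of `A` at discarded coordinates multiply states that are
already zero. -/
theorem isZeroExtension_state (G : DistSystem n nu ny) (h : r.Le n) (u : Signal nu) (t : ℕ) :
    IsZeroExtension h ((G.truncate h).state u t) ((G.masked r).state u t) := by
  induction t with
  | zero => exact ⟨fun _ _ => rfl, fun _ _ => rfl, fun _ _ _ => rfl, fun _ _ _ => rfl⟩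
  | succ t ih =>
    have hA : ∀ k q, ((G.truncate h).A t k *ᵥ inVec ((G.truncate h).state u t).1
          ((G.truncate h).state u t).2 k + (G.truncate h).B t k *ᵥ u t k) q =
        (G.A t k *ᵥ inVec ((G.masked r).state u t).1 ((G.masked r).state u t).2 k +
          G.B t k *ᵥ u t k) (h.keepOut (t + 1) k q) := fun k q =>
      congrArg (· + _) (congrFun (ih.submatrix_mulVec k (G.A t k) (h.keepOut (t + 1) k)) q)
    refine ⟨fun k a => ?_, fun e a => ?_, fun k a ha => ?_, fun e a ha => ?_⟩
    · exact (G.masked_mulVec_of_retained r _ _ (q := h.keepOut (t + 1) k (Sum.inl a)) a.2).trans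
        (hA k (Sum.inl a)).symm
    · exact (G.masked_mulVec_of_retained r _ _
        (q := h.keepOut (t + 1) e.1.1 (Sum.inr ⟨⟨e.1.2, e.2⟩, a⟩)) a.2).trans
        (hA e.1.1 (Sum.inr ⟨⟨e.1.2, e.2⟩, a⟩)).symm
    · exact G.masked_mulVec_of_not_retained r _ _ (q := Sum.inl a) ha
    · exact G.masked_mulVec_of_not_retained r _ _ (q := Sum.inr ⟨⟨e.1.2, e.2⟩, a⟩) ha

theorem output_truncate (G : DistSystem n nu ny) (h : r.Le n) (u : Signal nu) :
    (G.truncate h).output u = (G.masked r).output u := by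
  funext t k
  exact congrArg (· + _) ((G.isZeroExtension_state h u t).submatrix_mulVec k (G.C t k) id)

theorem IsStable.truncate {G : DistSystem n nu ny} (hG : (G.masked r).IsStable) (h : r.Le n) :
    (G.truncate h).IsStable := by
  intro u hu
  obtain ⟨h1, h2, h3⟩ := hG u hu
  refine ⟨?_, ?_, by rwa [output_truncate]⟩
  · refine memL2_of_sum_range_le zero_le_one (fun T => ?_) h1
    rw [one_mul]
    exact (sum_congr rfl fun t _ => sum_congr rfl fun k _ =>
      (G.isZeroExtension_state h u t).node_dotProduct k).le
  · refine memL2_of_sum_range_le zero_le_one (fun T => ?_) h2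
    rw [one_mul]
    exact (sum_congr rfl fun t _ => sum_congr rfl fun e _ =>
      (G.isZeroExtension_state h u t).edge_dotProduct e).le

/-! ### The error bound. -/

/-- The storage inequality for the truncation error, when the truncated weights are one. -/
theorem error_storage_le {G : DistSystem n nu ny} {w : ∀ t, StateVec n t} {θ : ℝ}
    (hc : G.CtrlDissipative w θ)
    (ho : ∀ t k (x : n.InIdx t k → ℝ),
      ∑ q, outVec (w (t + 1)).1 (w (t + 1)).2 k q * (G.A t k *ᵥ x) q ^ 2 +
        ∑ a, (G.C t k *ᵥ x) a ^ 2 ≤ ∑ q, inVec (w t).1 (w t).2 k q * x q ^ 2)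
    (h1 : ∀ t k (q : n.OutIdx t k), ¬ Retained r q → outVec (w t).1 (w t).2 k q = 1)
    (hθ1 : θ ≤ 1) (hw1 : ∀ t k a, 0 < (w t).1 k a)
    (hw2 : ∀ t e a, 0 < (w t).2 e a) (u : Signal nu) (t : ℕ) :
    StateVec.energy (w (t + 1)) (G.state u (t + 1) - (G.masked r).state u (t + 1)) +
        StateVec.energy (w (t + 1))⁻¹ (G.state u (t + 1) + (G.masked r).state u (t + 1)) +
        ∑ k, (G.output u t k - (G.masked r).output u t k) ⬝ᵥ
          (G.output u t k - (G.masked r).output u t k) ≤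
      StateVec.energy (w t) (G.state u t - (G.masked r).state u t) +
        StateVec.energy (w t)⁻¹ (G.state u t + (G.masked r).state u t) +
        4 * θ * ∑ k, u t k ⬝ᵥ u t k := by
  rw [← StateVec.sum_energy_outVec, ← StateVec.sum_energy_outVec, ← StateVec.sum_energy_inVec,
    ← StateVec.sum_energy_inVec, mul_sum, ← sum_add_distrib, ← sum_add_distrib,
    ← sum_add_distrib, ← sum_add_distrib]
  refine sum_le_sum fun k _ => ?_
  simp only [StateVec.outVec_inv, StateVec.inVec_inv, StateVec.outVec_sub, StateVec.outVec_add,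
    StateVec.inVec_sub, StateVec.inVec_add, outVec_state_succ]
  set x := inVec (G.state u t).1 (G.state u t).2 k with hx
  set y := inVec ((G.masked r).state u t).1 ((G.masked r).state u t).2 k with hy
  -- Here `b` is the unmasked step taken from the masked state, and `b'` is the actual step of the
  -- masked system.
  have hmask := sum_energy_masked_le (d := outVec (w (t + 1)).1 (w (t + 1)).2 k)
    (a := G.A t k *ᵥ x + G.B t k *ᵥ u t k) (b := G.A t k *ᵥ y + G.B t k *ᵥ u t k)
    (b' := (G.masked r).A t k *ᵥ y + (G.masked r).B t k *ᵥ u t k) fun q => by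
      by_cases hq : Retained r q
      · exact Or.inl (G.masked_mulVec_of_retained r _ _ hq)
      · exact Or.inr ⟨G.masked_mulVec_of_not_retained r _ _ hq, h1 _ _ q hq⟩
  have hdiff : ∀ q, (G.A t k *ᵥ x + G.B t k *ᵥ u t k) q - (G.A t k *ᵥ y + G.B t k *ᵥ u t k) q =
      (G.A t k *ᵥ (x - y)) q := fun q => by
    simp only [Matrix.mulVec_sub, Pi.sub_apply, Pi.add_apply]; ring
  -- Both systems receive `u`, so their sum is driven by `2u`, the source of the factor `4`.
  have hsum : ∀ q, (G.A t k *ᵥ x + G.B t k *ᵥ u t k) q + (G.A t k *ᵥ y + G.B t k *ᵥ u t k) q =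
      (G.A t k *ᵥ (x + y) + G.B t k *ᵥ ((2 : ℝ) • u t k)) q := fun q => by
    simp only [Matrix.mulVec_add, Matrix.mulVec_smul, Pi.add_apply, Pi.smul_apply, smul_eq_mul]
    ring
  have hout : G.output u t k - (G.masked r).output u t k = G.C t k *ᵥ (x - y) := by
    rw [Matrix.mulVec_sub]
    exact add_sub_add_right_eq_sub _ _ _
  have hu : ∑ a, ((2 : ℝ) • u t k) a ^ 2 = 4 * ∑ a, u t k a ^ 2 := by
    rw [mul_sum]
    exact sum_congr rfl fun a _ => by simp only [Pi.smul_apply, smul_eq_mul]; ring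
  -- Nonnegativity allows `θ` times this energy to be relaxed to the energy itself; `θ` is kept only
  -- on the input term.
  have hR : 0 ≤ ∑ q, (inVec (w t).1 (w t).2 k q)⁻¹ * (x + y) q ^ 2 := by
    refine sum_nonneg fun q _ => mul_nonneg (inv_nonneg.2 ?_) (sq_nonneg _)
    rcases q with a | ⟨i, a⟩
    · exact (hw1 _ _ _).le
    · exact (hw2 _ _ _).le
  have hcc := hc t k (x + y) ((2 : ℝ) • u t k)
  have hoo := ho t k (x - y)
  simp only [hdiff, hsum] at hmask
  rw [hu] at hcc
  rw [hout, dotProduct_self_eq_sum_sq, dotProduct_self_eq_sum_sq]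
  have := mul_le_mul_of_nonneg_right hθ1 hR
  linarith

/-- The truncation error bound, when the truncated weights are one. -/
theorem l2InducedNorm_sub_masked_le {G : DistSystem n nu ny} {w : ∀ t, StateVec n t} {θ : ℝ}
    (hc : G.CtrlDissipative w θ)
    (ho : ∀ t k (x : n.InIdx t k → ℝ),
      ∑ q, outVec (w (t + 1)).1 (w (t + 1)).2 k q * (G.A t k *ᵥ x) q ^ 2 +
        ∑ a, (G.C t k *ᵥ x) a ^ 2 ≤ ∑ q, inVec (w t).1 (w t).2 k q * x q ^ 2)
    (h1 : ∀ t k (q : n.OutIdx t k), ¬ Retained r q → outVec (w t).1 (w t).2 k q = 1)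
    (hθ0 : 0 ≤ θ) (hθ1 : θ ≤ 1) (hw1 : ∀ t k a, 0 < (w t).1 k a)
    (hw2 : ∀ t e a, 0 < (w t).2 e a) :
    l2InducedNorm (fun u => G.output u - (G.masked r).output u) ≤ ENNReal.ofReal √(4 * θ) := by
  refine iSup_le fun u => iSup_le fun _ => iSup_le fun _ => ENNReal.div_le_of_le_mul ?_
  refine l2Norm_le_of_sum_range_le (by positivity) fun T => ?_
  rw [mul_sum]
  refine sum_range_le_of_storage (V := fun t =>
    StateVec.energy (w t) (G.state u t - (G.masked r).state u t) +
      StateVec.energy (w t)⁻¹ (G.state u t + (G.masked r).state u t)) ?_ (fun t => ?_)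
    (error_storage_le hc ho h1 hθ1 hw1 hw2 u) T
  · have e1 : G.state u 0 - (G.masked r).state u 0 = 0 := sub_self _
    have e2 : G.state u 0 + (G.masked r).state u 0 = 0 := add_zero _
    simp only [e1, e2, StateVec.energy_zero, add_zero]
  · exact add_nonneg
      (StateVec.energy_nonneg (fun k a => (hw1 t k a).le) (fun e a => (hw2 t e a).le) _)
      (StateVec.energy_nonneg (fun k a => (inv_pos.2 (hw1 t k a)).le)
        (fun e a => (inv_pos.2 (hw2 t e a)).le) _)

end DistSystem

/-! ### Assembly. -/

theorem mainTheorem1 {V : Type*} [Fintype V] [DecidableEq V] {E : Finset (V × V)}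
    {n : StateDims E} {nu ny : ℕ → V → ℕ} (G : DistSystem n nu ny) (hG : G.UniformlyBounded)
    (S : GramianFamily n) (hS : G.IsBalanced S) (r : StateDims E) (hr : r.Le n)
    (hnode : ∀ t k, S.truncNode r t k = 1) (hedge : ∀ t e, S.truncEdge r t e = 1) :
    G.IsStable ∧ (G.truncate hr).IsStable ∧
      l2InducedNorm (fun u => G.output u - (G.truncate hr).output u) < 2 := by
  obtain ⟨b, hb⟩ := hG
  obtain ⟨hSb, hd, β, hβ, hgt, hctrl, hobsv⟩ := hS
  obtain ⟨c₀, hc1, hc2⟩ := hSb.exists_le hd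
  -- If all state dimensions vanish, `c₀` is unconstrained and may lie below `β`; hence the maximum
  -- with `β + 1`.
  obtain ⟨c, hcc, hcβ⟩ : ∃ c, c₀ ≤ c ∧ β < c :=
    ⟨max c₀ (β + 1), le_max_left _ _, (lt_add_one β).trans_le (le_max_right _ _)⟩
  replace hc1 := fun t k a => (hc1 t k a).trans hcc
  replace hc2 := fun t e a => (hc2 t e a).trans hcc
  have hc0 : 0 < c := hβ.trans hcβ
  have hw1 : ∀ t k a, 0 < (S.diagVec t).1 k a := fun t k a => hβ.trans (hgt.node_lt t k a)
  have hw2 : ∀ t e a, 0 < (S.diagVec t).2 e a := fun t e a => hβ.trans (hgt.edge_lt t e a)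
  have hθ0 : 0 ≤ 1 - β / c := sub_nonneg.2 ((div_le_one hc0).2 hcβ.le)
  have hθ1 : 1 - β / c < 1 := sub_lt_self _ (div_pos hβ hc0)
  have hdiss := hctrl.ctrlDissipative hd hβ hgt hcβ hc1 hc2
  have hC := fun t k => sum_sq_mulVec_le (hb t k).2.2.1
  have hD := fun t k => sum_sq_mulVec_le (hb t k).2.2.2
  refine ⟨hdiss.isStable hθ0 hθ1 hc0.le hw1 hw2 hc1 hc2 (sq_nonneg b) hC hD,
    DistSystem.IsStable.truncate ((hdiss.masked hw1 hw2 r).isStable hθ0 hθ1 hc0.le hw1 hw2 hc1 hc2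
      (sq_nonneg b) hC hD) hr, ?_⟩
  simp only [DistSystem.output_truncate]
  refine (DistSystem.l2InducedNorm_sub_masked_le hdiss (fun t k x => ?_) ?_ hθ0 hθ1.le
    hw1 hw2).trans_lt ?_
  · have h := hobsv t k
    rw [hd.inBlock_eq, hd.outBlock_eq] at h
    exact sum_mul_sq_mulVec_le_of_posDef hβ.le h x
  · rintro t k (a | ⟨j, a⟩) hq
    · have h := congrFun (congrFun (hnode t k) ⟨a, not_lt.1 hq⟩) ⟨a, not_lt.1 hq⟩
      rwa [Matrix.one_apply_eq] at h
    · have h := congrFun (congrFun (hedge t _) ⟨a, not_lt.1 hq⟩) ⟨a, not_lt.1 hq⟩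
      rwa [Matrix.one_apply_eq] at h
  -- This reduces to `4 * (1 - β / c) < 4`.
  · rw [ENNReal.ofReal_lt_iff_lt_toReal (Real.sqrt_nonneg _) (by norm_num)]
    rw [Real.sqrt_lt' (by norm_num)]
    norm_num
    linarith
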